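/- Let $\mathbb H=\{z\in\mathbb C:\operatorname{Im} z>0\}$, with pseudo-hyperbolic distance $d(z,w)=\left|\frac{w-z}{w-\overline z}\right|$. Let $\phi:\mathbb H\to\mathbb H$ be an analytic self-map of parabolic type with Denjoy–Wolff point $\infty$, i.e. $\phi(z)\to\infty$ and $\phi(z)/z\to1$ as $z\to\infty$ non-tangentially (that is, as $|z|\to\infty$ inside each sector $\{|\operatorname{Arg} z-\pi/2|<\theta_0\}$, $0<\theta_0<\pi/2$). Suppose that $\phi$ is of type I (non-zero step): writing $\phi_n$ for the $n$-th iterate of $\phi$ and $z_n=\phi_n(i)$, the steps $d(z_n,z_{n+1})$ tend to a limit $s_\infty>0$. Let $\{w_n\}_{n\ge0}\subset\mathbb H$ be a backward-iteration sequence with bounded steps (BISBS) for $\phi$, i.e. $\phi(w_{n+1})=w_n$ for all $n\ge0$, and there is a constant $a<1$ with $d(w_n,w_{n+1})\le a$ for all $n\ge 0$. Suppose that $w_n\to\infty$. Then $\{w_n\}$ has non-zero height: the sequence $\operatorname{Im} w_n$ is non-increasing and converges to a limit $\ell_\infty>0$. -/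

import Mathlib

open Filter Topology

/-- The open upper half-plane, as a subset of `ℂ`. -/
def upperHalf : Set ℂ := {z : ℂ | 0 < z.im}

/-- The pseudo-hyperbolic distance of the upper half-plane,
`d(z,w) = |(w - z) / (w - conj z)|`. For `z, w` in the upper half-plane the
denominator does not vanish. -/
noncomputable def pseudoHypDist (z w : ℂ) : ℝ :=
  ‖(w - z) / (w - (starRingEnd ℂ) z)‖

/-- The sector `{z : |Arg z - π/2| < θ}`. For `0 < θ < π/2` these are the non-tangential
approach regions for `∞` in the upper half-plane. -/
def sectorAtInfty (θ : ℝ) : Set ℂ := {z : ℂ | |z.arg - Real.pi / 2| < θ}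

/-- `f z` tends to `l` as `z → ∞` non-tangentially in the upper half-plane, i.e. as `|z| → ∞`
inside every sector `|Arg z - π/2| < θ` with `0 < θ < π/2`. (`Bornology.cobounded ℂ` is the
filter of neighbourhoods of the point `∞` of the Riemann sphere.) -/
def TendstoNontangentially (f : ℂ → ℂ) (l : Filter ℂ) : Prop :=
  ∀ θ : ℝ, 0 < θ → θ < Real.pi / 2 →
    Tendsto f (Bornology.cobounded ℂ ⊓ 𝓟 (sectorAtInfty θ)) l

/-- `φ` restricts to an analytic self-map of the upper half-plane, parabolic with Denjoy-Wolff
point `∞`: `φ z → ∞` and `φ z / z → 1` as `z → ∞` non-tangentially. -/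
structure IsParabolicSelfMap (φ : ℂ → ℂ) : Prop where
  analytic : DifferentiableOn ℂ φ upperHalf
  mapsTo : Set.MapsTo φ upperHalf upperHalf
  tendsto_infty : TendstoNontangentially φ (Bornology.cobounded ℂ)
  tendsto_div : TendstoNontangentially (fun z => φ z / z) (𝓝 1)

/-- Type I (non-zero step): for the forward orbit `z_n = φ^n(i)`, the steps `d(z_n, z_{n+1})`
tend to a limit `s_∞ > 0`. -/
def IsTypeI (φ : ℂ → ℂ) : Prop :=
  ∃ s : ℝ, 0 < s ∧
    Tendsto (fun n : ℕ => pseudoHypDist (φ^[n] Complex.I) (φ^[n + 1] Complex.I)) atTop (𝓝 s)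

/-- `w` is a backward-iteration sequence with bounded steps for the self-map `φ` of the upper
half-plane. -/
structure IsBISBS (φ : ℂ → ℂ) (w : ℕ → ℂ) : Prop where
  mem : ∀ n, w n ∈ upperHalf
  map_succ : ∀ n, φ (w (n + 1)) = w n
  bounded_steps : ∃ a : ℝ, a < 1 ∧ ∀ n, pseudoHypDist (w n) (w (n + 1)) ≤ a

/-! Write y_n = Im w_n and S_n = y_0 + ... + y_{n-1}. Julia's lemma (`IsParabolicSelfMap.im_le`)
makes y_n non-increasing; suppose y_n → 0. Bounded steps give |w_n - w_0| ≤ A S_n, so w_n → ∞ forces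
S_n → ∞. If also `hypRatio (w n) (w 0)` ≥ n²T with T > 0, then n² y_n ≤ B S_n². Telescoping 1/S_n
yields S_n/n ≥ 1/(2B), against Cesàro (`not_tendsto_zero_of_le_sq_mean`).

The bound n²T is the core (`sq_mul_le_hypRatio_of_tendsto`). By Schwarz–Pick it may be checked far
out on the forward orbit of w_0. Julia's lemma puts the displacement φ z - z in the closed
half-plane, so Schwarz–Pick applies to it too. Since the step sizes converge, near-equality makes
consecutive normalised steps asymptotically equal. A subsequential limit q gives an affine model
with heights κ^j, κ = 1 + Im q, where Cauchy–Schwarz gives n²T. Comparing displacements along two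
orbits transfers T > 0 from the orbit of i to that of w_0 (`IsTypeI.exists_pos_tendsto`). -/

/-! ### Hyperbolic ratio and Schwarz–Pick. -/

/-- The squared Euclidean distance normalised by the heights; for points of the upper half-plane
it is an increasing function of the hyperbolic distance. -/
noncomputable def hypRatio (z w : ℂ) : ℝ := ‖w - z‖ ^ 2 / (z.im * w.im)

lemma hypRatio_nonneg {z w : ℂ} (hz : 0 < z.im) (hw : 0 < w.im) : 0 ≤ hypRatio z w := by
  unfold hypRatio; positivity

lemma norm_sq_eq_re_im (z : ℂ) : ‖z‖ ^ 2 = z.re ^ 2 + z.im ^ 2 := by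
  rw [Complex.sq_norm, Complex.normSq_apply]; ring

lemma norm_sub_conj_sq (z w : ℂ) :
    ‖w - (starRingEnd ℂ) z‖ ^ 2 = ‖w - z‖ ^ 2 + 4 * (z.im * w.im) := by
  simp only [norm_sq_eq_re_im, Complex.sub_re, Complex.sub_im, Complex.conj_re, Complex.conj_im]
  ring

lemma pseudoHypDist_sq {z w : ℂ} (hz : 0 < z.im) (hw : 0 < w.im) :
    pseudoHypDist z w ^ 2 = hypRatio z w / (hypRatio z w + 4) := by
  unfold pseudoHypDist hypRatio
  rw [norm_div, div_pow, norm_sub_conj_sq]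
  have := mul_pos hz hw
  have h2 := sq_nonneg ‖w - z‖
  field_simp

lemma hypRatio_le_of_pseudoHypDist_le {z w z' w' : ℂ} (hz : 0 < z.im) (hw : 0 < w.im)
    (hz' : 0 < z'.im) (hw' : 0 < w'.im) (h : pseudoHypDist z w ≤ pseudoHypDist z' w') :
    hypRatio z w ≤ hypRatio z' w' := by
  have h2 : pseudoHypDist z w ^ 2 ≤ pseudoHypDist z' w' ^ 2 :=
    pow_le_pow_left₀ (norm_nonneg _) h 2
  rw [pseudoHypDist_sq hz hw, pseudoHypDist_sq hz' hw'] at h2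
  have h3 := hypRatio_nonneg hz hw
  have h4 := hypRatio_nonneg hz' hw'
  rw [div_le_div_iff₀ (by positivity) (by positivity)] at h2
  linarith

lemma ne_conj_of_im_pos {z w : ℂ} (hz : 0 < z.im) (hw : 0 < w.im) :
    w - (starRingEnd ℂ) z ≠ 0 := by
  intro h
  have := congrArg Complex.im h
  simp at this
  linarith

/-- The Schwarz–Pick lemma in the upper half-plane. -/
lemma pseudoHypDist_map_le {f : ℂ → ℂ} (hf : DifferentiableOn ℂ f upperHalf)
    (hm : Set.MapsTo f upperHalf upperHalf) {z w : ℂ} (hz : z ∈ upperHalf) (hw : w ∈ upperHalf) :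
    pseudoHypDist (f z) (f w) ≤ pseudoHypDist z w := by
  have hz0 : 0 < z.im := hz
  -- Inverse Cayley map sending 0 to z; Cayley maps on both sides reduce the claim to the Schwarz
  -- lemma on the disc.
  set g : ℂ → ℂ := fun ζ => (z - (starRingEnd ℂ) z * ζ) / (1 - ζ) with hg
  have hne : ∀ ζ ∈ Metric.ball (0 : ℂ) 1, (1 : ℂ) - ζ ≠ 0 := by
    intro ζ hζ h
    rw [mem_ball_zero_iff] at hζ
    have : ζ = 1 := by linear_combination -h
    simp [this] at hζ
  have hgm : Set.MapsTo g (Metric.ball 0 1) upperHalf := by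
    intro ζ hζ
    have h1 := hne ζ hζ
    rw [mem_ball_zero_iff] at hζ
    have h2 : 0 < Complex.normSq (1 - ζ) := Complex.normSq_pos.mpr h1
    have h3 : (g ζ).im = z.im * (1 - ‖ζ‖ ^ 2) / Complex.normSq (1 - ζ) := by
      simp only [hg, Complex.div_im, norm_sq_eq_re_im]
      simp
      field_simp
      ring
    change 0 < (g ζ).im
    rw [h3]
    have : ‖ζ‖ ^ 2 < 1 := by nlinarith [norm_nonneg ζ]
    exact div_pos (mul_pos hz0 (by linarith)) h2
  have hgd : DifferentiableOn ℂ g (Metric.ball 0 1) := by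
    intro ζ hζ
    have := hne ζ hζ
    apply DifferentiableAt.differentiableWithinAt
    fun_prop (disch := exact this)
  set F : ℂ → ℂ := fun ζ => (f (g ζ) - f z) / (f (g ζ) - (starRingEnd ℂ) (f z)) with hF
  have hfd : DifferentiableOn ℂ (fun ζ => f (g ζ)) (Metric.ball 0 1) := hf.comp hgd hgm
  have hFd : DifferentiableOn ℂ F (Metric.ball 0 1) := by
    refine (hfd.sub_const _).div (hfd.sub_const _) ?_
    intro ζ hζ
    exact ne_conj_of_im_pos (hm hz) (hm (hgm hζ))
  have hg0 : g 0 = z := by simp [hg]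
  have hF0 : F 0 = 0 := by simp [hF, hg0]
  have hFm : Set.MapsTo F (Metric.ball 0 1) (Metric.closedBall (F 0) 1) := by
    intro ζ hζ
    rw [hF0, mem_closedBall_zero_iff]
    have h1 : 0 < (f (g ζ)).im := hm (hgm hζ)
    have h2 : 0 < (f z).im := hm hz
    have h3 := norm_sub_conj_sq (f z) (f (g ζ))
    simp only [hF, norm_div]
    apply div_le_one_of_le₀ _ (norm_nonneg _)
    refine (pow_le_pow_iff_left₀ (norm_nonneg _) (norm_nonneg _) two_ne_zero).mp ?_
    nlinarith [mul_pos h1 h2]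
  set ζ := (w - z) / (w - (starRingEnd ℂ) z) with hζdef
  have hd := ne_conj_of_im_pos hz hw
  have hζ : ζ ∈ Metric.ball (0 : ℂ) 1 := by
    rw [mem_ball_zero_iff, hζdef, norm_div, div_lt_one (norm_pos_iff.mpr hd)]
    have h3 := norm_sub_conj_sq z w
    have hw0 : 0 < w.im := hw
    apply lt_of_pow_lt_pow_left₀ 2 (norm_nonneg _)
    nlinarith [mul_pos hz0 hw0]
  have hgζ : g ζ = w := by
    have h1 := hne ζ hζ
    simp only [hg]
    rw [div_eq_iff h1, hζdef]
    field_simp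
    ring
  have key := Complex.dist_le_div_mul_dist_of_mapsTo_ball hFd hFm hζ
  rw [hF0, dist_zero_right, dist_zero_right, div_one, one_mul] at key
  simpa only [pseudoHypDist, hF, hgζ] using key

lemma hypRatio_map_le {f : ℂ → ℂ} (hf : DifferentiableOn ℂ f upperHalf)
    (hm : Set.MapsTo f upperHalf upperHalf) {z w : ℂ} (hz : z ∈ upperHalf) (hw : w ∈ upperHalf) :
    hypRatio (f z) (f w) ≤ hypRatio z w :=
  hypRatio_le_of_pseudoHypDist_le (hm hz) (hm hw) hz hw (pseudoHypDist_map_le hf hm hz hw)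

/-- The Schwarz–Pick lemma for maps into the closed upper half-plane. -/
lemma norm_map_sub_sq_le {f : ℂ → ℂ} (hf : DifferentiableOn ℂ f upperHalf)
    (hm : ∀ z ∈ upperHalf, 0 ≤ (f z).im) {z w : ℂ} (hz : z ∈ upperHalf) (hw : w ∈ upperHalf) :
    ‖f w - f z‖ ^ 2 ≤ hypRatio z w * ((f z).im * (f w).im) := by
  -- Shifting by εi lands in the open half-plane; then ε → 0.
  have key : ∀ ε : ℝ, 0 < ε →
      ‖f w - f z‖ ^ 2 ≤ hypRatio z w * (((f z).im + ε) * ((f w).im + ε)) := by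
    intro ε hε
    have hm' : Set.MapsTo (fun z => f z + ε * Complex.I) upperHalf upperHalf := by
      intro v hv
      have := hm v hv
      simp [upperHalf]
      linarith
    have h := hypRatio_map_le (hf.add_const _) hm' hz hw
    have h1 := hm z hz
    have h2 := hm w hw
    conv_lhs at h => unfold hypRatio
    rw [div_le_iff₀ (mul_pos (hm' hz) (hm' hw))] at h
    simpa using h
  have hlim : Tendsto (fun ε : ℝ => hypRatio z w * (((f z).im + ε) * ((f w).im + ε)))
      (𝓝[>] 0) (𝓝 (hypRatio z w * (((f z).im + 0) * ((f w).im + 0)))) := by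
    apply Tendsto.mono_left _ nhdsWithin_le_nhds
    exact Continuous.tendsto (by fun_prop) 0
  simp only [add_zero] at hlim
  exact ge_of_tendsto hlim (eventually_nhdsWithin_of_forall fun ε hε => key ε hε)

lemma hypRatio_iterate_le {φ : ℂ → ℂ} (hφ : IsParabolicSelfMap φ) (n : ℕ) {z w : ℂ}
    (hz : z ∈ upperHalf) (hw : w ∈ upperHalf) :
    hypRatio (φ^[n] z) (φ^[n] w) ≤ hypRatio z w := by
  induction n with
  | zero => simp
  | succ n ih =>
    rw [Function.iterate_succ_apply', Function.iterate_succ_apply']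
    exact (hypRatio_map_le hφ.analytic hφ.mapsTo (hφ.mapsTo.iterate n hz)
      (hφ.mapsTo.iterate n hw)).trans ih

/-! ### Julia's lemma and the displacement. -/

/-- Julia's lemma at infinity for parabolic maps. -/
lemma IsParabolicSelfMap.im_le {φ : ℂ → ℂ} (hφ : IsParabolicSelfMap φ) {z : ℂ}
    (hz : z ∈ upperHalf) : z.im ≤ (φ z).im := by
  have hdir : Tendsto (fun t : ℝ => (t : ℂ) * Complex.I) atTop
      (Bornology.cobounded ℂ ⊓ 𝓟 (sectorAtInfty (Real.pi / 4))) := by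
    refine tendsto_inf.mpr ⟨?_, tendsto_principal.mpr ?_⟩
    · rw [← tendsto_norm_atTop_iff_cobounded]
      simpa using tendsto_abs_atTop_atTop
    · filter_upwards [eventually_gt_atTop 0] with t ht
      simp only [sectorAtInfty, Set.mem_ofPred_eq]
      rw [Complex.arg_real_mul _ ht, Complex.arg_I, sub_self, abs_zero]
      positivity
  have h1 := (hφ.tendsto_div (Real.pi / 4) (by positivity) (by linarith [Real.pi_pos])).comp hdir
  have h2 : Tendsto (fun t : ℝ => φ (t * Complex.I) / t) atTop (𝓝 Complex.I) := by
    have h3 := h1.mul_const Complex.I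
    rw [one_mul] at h3
    refine h3.congr' ?_
    filter_upwards [eventually_gt_atTop 0] with t ht
    have : (t : ℂ) ≠ 0 := by exact_mod_cast ht.ne'
    simp only [Function.comp]
    field_simp
  have h0 : ∀ c : ℂ, Tendsto (fun t : ℝ => c / (t : ℂ)) atTop (𝓝 0) := by
    intro c
    have : Tendsto (fun t : ℝ => c * ((t⁻¹ : ℝ) : ℂ)) atTop (𝓝 (c * ((0 : ℝ) : ℂ))) :=
      ((Complex.continuous_ofReal.tendsto 0).comp tendsto_inv_atTop_zero).const_mul c
    simpa [div_eq_mul_inv] using this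
  -- Schwarz–Pick for z and it, cleared of denominators, has both sides of order t³; dividing by t³
  -- and letting t → ∞ leaves the heights.
  have hL : Tendsto (fun t : ℝ => ‖φ (t * Complex.I) / t - φ z / t‖ ^ 2 * z.im) atTop
      (𝓝 (‖Complex.I - 0‖ ^ 2 * z.im)) := (((h2.sub (h0 _)).norm).pow 2).mul_const _
  have hR : Tendsto (fun t : ℝ => ‖Complex.I - z / t‖ ^ 2 * ((φ z).im * (φ (t * Complex.I) / t).im))
      atTop (𝓝 (‖Complex.I - 0‖ ^ 2 * ((φ z).im * Complex.I.im))) :=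
    (((tendsto_const_nhds.sub (h0 _)).norm).pow 2).mul
      (((Complex.continuous_im.tendsto _).comp h2).const_mul _)
  have hle := le_of_tendsto_of_tendsto hL hR ?_
  · simpa using hle
  filter_upwards [eventually_gt_atTop 0] with t ht
  have htne : (t : ℂ) ≠ 0 := by exact_mod_cast ht.ne'
  have htI : (t : ℂ) * Complex.I ∈ upperHalf := by simpa [upperHalf] using ht
  have hz0 : 0 < z.im := hz
  have hsp := hypRatio_map_le hφ.analytic hφ.mapsTo hz htI
  unfold hypRatio at hsp
  have hi : (↑t * Complex.I).im = t := by simp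
  rw [hi, div_le_div_iff₀ (mul_pos (hφ.mapsTo hz) (hφ.mapsTo htI)) (by positivity)] at hsp
  have e1 : φ (t * Complex.I) / t - φ z / t = (φ (t * Complex.I) - φ z) / t := by ring
  have e2 : Complex.I - z / t = (t * Complex.I - z) / t := by field_simp
  rw [e1, e2, Complex.div_ofReal_im, norm_div, norm_div, Complex.norm_real, Real.norm_eq_abs,
    abs_of_pos ht, div_pow, div_pow]
  have ht3 : 0 < t ^ 3 := by positivity
  have := div_le_div_of_nonneg_right hsp ht3.le
  calc _ = ‖φ (t * Complex.I) - φ z‖ ^ 2 * (z.im * t) / t ^ 3 := by field_simp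
    _ ≤ _ := this
    _ = _ := by field_simp

/-- Schwarz–Pick for the displacement `φ z - z`. -/
lemma IsParabolicSelfMap.norm_displacement_sub_sq_le {φ : ℂ → ℂ} (hφ : IsParabolicSelfMap φ)
    {z w : ℂ} (hz : z ∈ upperHalf) (hw : w ∈ upperHalf) :
    ‖(φ w - w) - (φ z - z)‖ ^ 2 ≤ hypRatio z w * ((φ z - z).im * (φ w - w).im) :=
  norm_map_sub_sq_le (f := fun z => φ z - z) (hφ.analytic.sub differentiableOn_id)
    (fun v hv => by simpa using hφ.im_le hv) hz hw

/-! ### Two elementary inequalities for steps. -/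

/-- Near-equality in the Schwarz–Pick inequality for two consecutive normalised steps `q`, `q'`
forces them to be close. -/
lemma norm_sub_sq_le_of_step {q q' : ℂ} {a b : ℝ} (ha : 0 ≤ a) (hb : 0 ≤ b)
    (hd : ‖q' * (1 + (a : ℂ) ^ 2) - q‖ ≤ a * b * ‖q‖) :
    ‖q' - q‖ ^ 2 ≤ 2 * (a * b + a ^ 2) * ((1 + a ^ 2) ^ 2 * (1 + b ^ 2)) *
      (‖q‖ ^ 2 / (1 + a ^ 2) - ‖q'‖ ^ 2 / (1 + b ^ 2)) := by
  set d := q' * (1 + (a : ℂ) ^ 2) - q with hd_def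
  set t := a * b with ht
  have ht0 : 0 ≤ t := mul_nonneg ha hb
  have hq'norm : ‖q + d‖ = ‖q'‖ * (1 + a ^ 2) := by
    have : q + d = q' * ((1 + a ^ 2 : ℝ) : ℂ) := by rw [hd_def]; push_cast; ring
    rw [this, norm_mul, Complex.norm_real, Real.norm_eq_abs, abs_of_pos (by positivity)]
  have hdsq : ‖d‖ ^ 2 ≤ t ^ 2 * ‖q‖ ^ 2 := by
    rw [← mul_pow]; exact pow_le_pow_left₀ (norm_nonneg _) hd 2
  have htri : ‖q + d‖ ≤ (1 + t) * ‖q‖ := (norm_add_le _ _).trans (by linarith)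
  have htri2 : ‖q + d‖ ^ 2 ≤ (1 + t) ^ 2 * ‖q‖ ^ 2 := by
    rw [← mul_pow]; exact pow_le_pow_left₀ (norm_nonneg _) htri 2
  -- On the disc |d| ≤ t|q|, the norm |q + d| is maximal only at d = tq; this is the quantitative
  -- form.
  have hpar : ‖d - t * q‖ ^ 2 ≤ t * ((1 + t) ^ 2 * ‖q‖ ^ 2 - ‖q + d‖ ^ 2) := by
    have e : ‖d - t * q‖ ^ 2 =
        ‖d‖ ^ 2 * (1 + t) + t ^ 2 * ‖q‖ ^ 2 + t * ‖q‖ ^ 2 - t * ‖q + d‖ ^ 2 := by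
      simp only [norm_sq_eq_re_im, Complex.sub_re, Complex.sub_im, Complex.add_re, Complex.add_im,
        Complex.re_ofReal_mul, Complex.im_ofReal_mul]
      ring
    rw [e]
    nlinarith
  set R := (1 + a ^ 2) ^ 2 * (1 + b ^ 2) *
      (‖q‖ ^ 2 / (1 + a ^ 2) - ‖q'‖ ^ 2 / (1 + b ^ 2)) with hR
  -- From (1 + ab)² = (1 + a²)(1 + b²) - (a - b)²: R controls both the defect and a - b.
  have hE : (1 + t) ^ 2 * ‖q‖ ^ 2 - ‖q + d‖ ^ 2 = R - (a - b) ^ 2 * ‖q‖ ^ 2 := by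
    rw [hR, hq'norm, ht]
    field_simp
    ring
  have h1 : (a - b) ^ 2 * ‖q‖ ^ 2 ≤ R := by linarith
  have h2 : (1 + t) ^ 2 * ‖q‖ ^ 2 - ‖q + d‖ ^ 2 ≤ R := by
    rw [hE]; nlinarith [mul_nonneg (sq_nonneg (a - b)) (sq_nonneg ‖q‖)]
  have h3 : ‖d - t * q‖ ^ 2 ≤ t * R := hpar.trans (mul_le_mul_of_nonneg_left h2 ht0)
  have h4 : ‖((a * (b - a) : ℝ) : ℂ) * q‖ ^ 2 ≤ a ^ 2 * R := by
    rw [norm_mul, mul_pow, Complex.norm_real, Real.norm_eq_abs, sq_abs]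
    calc _ = a ^ 2 * ((a - b) ^ 2 * ‖q‖ ^ 2) := by ring
      _ ≤ _ := mul_le_mul_of_nonneg_left h1 (sq_nonneg a)
  have h5 : ‖(q' - q) * ((1 + a ^ 2 : ℝ) : ℂ)‖ ^ 2 ≤ 2 * (t * R + a ^ 2 * R) := by
    have e : (q' - q) * ((1 + a ^ 2 : ℝ) : ℂ) = (d - t * q) + ((a * (b - a) : ℝ) : ℂ) * q := by
      rw [hd_def, ht]; push_cast; ring
    rw [e]
    have := pow_le_pow_left₀ (norm_nonneg _) (norm_add_le (d - t * q) (((a * (b - a) : ℝ) : ℂ) * q)) 2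
    nlinarith [sq_nonneg (‖d - t * q‖ - ‖((a * (b - a) : ℝ) : ℂ) * q‖)]
  have h6 : ‖q' - q‖ ^ 2 ≤ ‖(q' - q) * ((1 + a ^ 2 : ℝ) : ℂ)‖ ^ 2 := by
    rw [norm_mul, Complex.norm_real, Real.norm_eq_abs, abs_of_pos (by positivity)]
    apply pow_le_pow_left₀ (norm_nonneg _)
    nlinarith [norm_nonneg (q' - q), mul_nonneg (norm_nonneg (q' - q)) (sq_nonneg a)]
  calc _ ≤ _ := h6.trans h5
    _ = _ := by rw [hR]; ring

/-- Cauchy–Schwarz between the powers of √k and the same powers in reverse order, whose products are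
all equal. -/
lemma sq_mul_pow_le_geom_sum_sq {k : ℝ} (hk : 0 ≤ k) (n : ℕ) :
    (n : ℝ) ^ 2 * k ^ n ≤ k * (∑ i ∈ Finset.range n, k ^ i) ^ 2 := by
  rcases n with _ | n
  · simp
  obtain ⟨r, hr, rfl⟩ : ∃ r : ℝ, 0 ≤ r ∧ k = r ^ 2 := ⟨√k, Real.sqrt_nonneg k, by simp [hk]⟩
  have h := Finset.sum_mul_sq_le_sq_mul_sq (Finset.range (n + 1)) (fun i => r ^ i)
    (fun i => r ^ (n - i))
  have e1 : ∑ i ∈ Finset.range (n + 1), r ^ i * r ^ (n - i) = (n + 1) * r ^ n := by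
    rw [Finset.sum_congr rfl (g := fun _ => r ^ n)]
    · simp
    · intro i hi
      rw [← pow_add]
      congr 1
      have := Finset.mem_range.mp hi
      omega
  have e2 : ∑ i ∈ Finset.range (n + 1), (r ^ (n - i)) ^ 2 =
      ∑ i ∈ Finset.range (n + 1), (r ^ i) ^ 2 := by
    have := Finset.sum_range_reflect (fun i => (r ^ i) ^ 2) (n + 1)
    simpa using this
  have e3 : ∑ i ∈ Finset.range (n + 1), (r ^ i) ^ 2 = ∑ i ∈ Finset.range (n + 1), (r ^ 2) ^ i :=
    Finset.sum_congr rfl fun i _ => by rw [← pow_mul, ← pow_mul, mul_comm]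
  rw [e1, e2, e3] at h
  push_cast
  calc _ = r ^ 2 * ((n + 1) * r ^ n) ^ 2 := by ring
    _ ≤ r ^ 2 * ((∑ i ∈ Finset.range (n + 1), (r ^ 2) ^ i) *
        ∑ i ∈ Finset.range (n + 1), (r ^ 2) ^ i) := mul_le_mul_of_nonneg_left h (by positivity)
    _ = _ := by ring

lemma IsParabolicSelfMap.iterate_mem {φ : ℂ → ℂ} (hφ : IsParabolicSelfMap φ) {z : ℂ}
    (hz : z ∈ upperHalf) (n : ℕ) : φ^[n] z ∈ upperHalf := hφ.mapsTo.iterate n hz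

/-! ### Normalised steps along forward orbits. -/

/-- The displacement of `φ` at `z`, normalised by the height of `z`. -/
noncomputable def normStep (φ : ℂ → ℂ) (z : ℂ) : ℂ := (φ z - z) / (z.im : ℂ)

section Steps

variable {φ : ℂ → ℂ} {z : ℂ}

lemma normStep_im (φ : ℂ → ℂ) (z : ℂ) : (normStep φ z).im = (φ z - z).im / z.im := by
  rw [normStep, Complex.div_ofReal_im]

lemma norm_normStep (hz : z ∈ upperHalf) : ‖normStep φ z‖ = ‖φ z - z‖ / z.im := by
  have hz0 : 0 < z.im := hz
  rw [normStep, norm_div, Complex.norm_real, Real.norm_eq_abs, abs_of_pos hz0]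

lemma normStep_im_nonneg (hφ : IsParabolicSelfMap φ) (hz : z ∈ upperHalf) :
    0 ≤ (normStep φ z).im := by
  have hz0 : 0 < z.im := hz
  rw [normStep_im]
  exact div_nonneg (by simpa using hφ.im_le hz) hz0.le

lemma im_map_eq (hz : z ∈ upperHalf) : (φ z).im = z.im * (1 + (normStep φ z).im) := by
  have hz0 : z.im ≠ 0 := ne_of_gt hz
  rw [normStep_im, Complex.sub_im]
  field_simp
  ring

lemma map_sub_eq (hz : z ∈ upperHalf) : φ z - z = z.im * normStep φ z := by
  have hz0 : (z.im : ℂ) ≠ 0 := by exact_mod_cast ne_of_gt hz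
  rw [normStep]
  field_simp

lemma hypRatio_map_eq (hz : z ∈ upperHalf) :
    hypRatio z (φ z) = ‖normStep φ z‖ ^ 2 / (1 + (normStep φ z).im) := by
  have hz0 : 0 < z.im := hz
  rw [hypRatio, im_map_eq hz, norm_normStep hz]
  field_simp

lemma norm_normStep_le (hφ : IsParabolicSelfMap φ) (hz : z ∈ upperHalf) :
    ‖normStep φ z‖ ^ 2 ≤ hypRatio z (φ z) * (1 + ‖normStep φ z‖) := by
  have h := normStep_im_nonneg hφ hz
  have h2 := Complex.abs_im_le_norm (normStep φ z)
  rw [abs_of_nonneg h] at h2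
  have h3 := hypRatio_nonneg (show 0 < z.im from hz) (hφ.mapsTo hz)
  have h4 := hypRatio_map_eq (φ := φ) hz
  rw [eq_div_iff (by positivity)] at h4
  rw [← h4]
  exact mul_le_mul_of_nonneg_left (by linarith) h3

lemma norm_normStep_le_of_hypRatio_le (hφ : IsParabolicSelfMap φ) (hz : z ∈ upperHalf) {M : ℝ}
    (hM : hypRatio z (φ z) ≤ M) : ‖normStep φ z‖ ≤ 1 + M := by
  have h := norm_normStep_le hφ hz
  have h3 := hypRatio_nonneg (show 0 < z.im from hz) (hφ.mapsTo hz)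
  by_contra! hlt
  nlinarith [norm_nonneg (normStep φ z)]

/-- Schwarz–Pick for the displacement at z and φ z is the hypothesis of `norm_sub_sq_le_of_step`,
with a², b² the imaginary parts of the two steps. -/
lemma norm_normStep_map_sub_sq_le (hφ : IsParabolicSelfMap φ) (hz : z ∈ upperHalf) :
    ‖normStep φ (φ z) - normStep φ z‖ ^ 2 ≤
      2 * (√(normStep φ z).im * √(normStep φ (φ z)).im + (normStep φ z).im) *
        ((1 + (normStep φ z).im) ^ 2 * (1 + (normStep φ (φ z)).im)) *
      (hypRatio z (φ z) - hypRatio (φ z) (φ (φ z))) := by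
  have hz0 : 0 < z.im := hz
  have hz1 := hφ.mapsTo hz
  have hz10 : 0 < (φ z).im := hz1
  have hα := normStep_im_nonneg hφ hz
  have hβ := normStep_im_nonneg hφ hz1
  set a := √(normStep φ z).im with ha
  set b := √(normStep φ (φ z)).im with hb
  have ha2 : a ^ 2 = (normStep φ z).im := Real.sq_sqrt hα
  have hb2 : b ^ 2 = (normStep φ (φ z)).im := Real.sq_sqrt hβ
  have hsp := hφ.norm_displacement_sub_sq_le hz hz1
  rw [hypRatio_map_eq hz, hypRatio_map_eq hz1, ← ha2, ← hb2]
  apply norm_sub_sq_le_of_step (Real.sqrt_nonneg _) (Real.sqrt_nonneg _)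
  refine (pow_le_pow_iff_left₀ (norm_nonneg _) (by positivity) two_ne_zero).mp ?_
  have e : normStep φ (φ z) * (1 + (a : ℂ) ^ 2) - normStep φ z =
      ((φ (φ z) - φ z) - (φ z - z)) / (z.im : ℂ) := by
    have h1 : ((a : ℂ)) ^ 2 = ((normStep φ z).im : ℂ) := by rw [← ha2]; push_cast; rfl
    have h2 : ((φ z).im : ℂ) = z.im * (1 + (normStep φ z).im) := by
      rw [im_map_eq hz]; push_cast; rfl
    have hzc : (z.im : ℂ) ≠ 0 := by exact_mod_cast hz0.ne'
    rw [map_sub_eq hz1, map_sub_eq hz, h1, h2]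
    field_simp
  rw [e, norm_div, Complex.norm_real, Real.norm_eq_abs, abs_of_pos hz0, div_pow,
    div_le_iff₀ (by positivity)]
  refine hsp.trans (le_of_eq ?_)
  have i1 : (φ z - z).im = z.im * a ^ 2 := by rw [ha2, normStep_im]; field_simp
  have i2 : (φ (φ z) - φ z).im = (φ z).im * b ^ 2 := by rw [hb2, normStep_im]; field_simp
  rw [hypRatio, i1, i2, norm_normStep hz]
  field_simp
  rw [← ha, ← hb]

/-- The steps of a forward orbit, measured by `hypRatio`, decrease. -/
lemma antitone_hypRatio_orbit (hφ : IsParabolicSelfMap φ) (hz : z ∈ upperHalf) :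
    Antitone fun m => hypRatio (φ^[m] z) (φ (φ^[m] z)) := by
  refine antitone_nat_of_succ_le fun m => ?_
  have h := hφ.iterate_mem hz m
  rw [Function.iterate_succ_apply']
  exact hypRatio_map_le hφ.analytic hφ.mapsTo h (hφ.mapsTo h)

lemma hypRatio_orbit_nonneg (hφ : IsParabolicSelfMap φ) (hz : z ∈ upperHalf) (m : ℕ) :
    0 ≤ hypRatio (φ^[m] z) (φ (φ^[m] z)) :=
  hypRatio_nonneg (hφ.iterate_mem hz m) (hφ.mapsTo (hφ.iterate_mem hz m))

lemma norm_normStep_orbit_le (hφ : IsParabolicSelfMap φ) (hz : z ∈ upperHalf) (m : ℕ) :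
    ‖normStep φ (φ^[m] z)‖ ≤ 1 + hypRatio z (φ z) :=
  norm_normStep_le_of_hypRatio_le hφ (hφ.iterate_mem hz m)
    (antitone_hypRatio_orbit hφ hz (Nat.zero_le m))

lemma tendsto_normStep_sub (hφ : IsParabolicSelfMap φ) (hz : z ∈ upperHalf) {T : ℝ}
    (hT : Tendsto (fun m => hypRatio (φ^[m] z) (φ (φ^[m] z))) atTop (𝓝 T)) :
    Tendsto (fun m => normStep φ (φ^[m + 1] z) - normStep φ (φ^[m] z)) atTop (𝓝 0) := by
  set M := 1 + hypRatio z (φ z) with hM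
  have hM0 : 0 ≤ M := (norm_nonneg _).trans (norm_normStep_orbit_le hφ hz 0)
  have him : ∀ m, (normStep φ (φ^[m] z)).im ≤ M := fun m =>
    ((le_abs_self _).trans (Complex.abs_im_le_norm _)).trans (norm_normStep_orbit_le hφ hz m)
  have hlim : Tendsto (fun m => 2 * (√M * √M + M) * ((1 + M) ^ 2 * (1 + M)) *
      (hypRatio (φ^[m] z) (φ (φ^[m] z)) - hypRatio (φ^[m + 1] z) (φ (φ^[m + 1] z)))) atTop
      (𝓝 0) := by
    have := (hT.sub (hT.comp (tendsto_add_atTop_nat 1))).const_mul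
      (2 * (√M * √M + M) * ((1 + M) ^ 2 * (1 + M)))
    simpa using this
  have hsq : Tendsto (fun m => ‖normStep φ (φ^[m + 1] z) - normStep φ (φ^[m] z)‖ ^ 2) atTop
      (𝓝 0) := by
    refine squeeze_zero (fun m => sq_nonneg _) (fun m => ?_) hlim
    have h0 := normStep_im_nonneg hφ (hφ.iterate_mem hz m)
    have h1 := normStep_im_nonneg hφ (hφ.iterate_mem hz (m + 1))
    have hb0 := him m
    have hb1 := him (m + 1)
    have hanti := antitone_hypRatio_orbit hφ hz (Nat.le_succ m)
    have h := norm_normStep_map_sub_sq_le hφ (hφ.iterate_mem hz m)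
    rw [← Function.iterate_succ_apply' φ m z] at h
    refine h.trans ?_
    simp only [← Function.iterate_succ_apply' φ] at hanti ⊢
    refine mul_le_mul_of_nonneg_right ?_ (sub_nonneg.mpr hanti)
    gcongr
  rw [tendsto_zero_iff_norm_tendsto_zero]
  have := hsq.sqrt
  simpa [Real.sqrt_sq] using this

/-- Along a forward orbit, `n` steps are at least as long as `n` steps of a parabolic
automorphism. -/
lemma sq_mul_le_hypRatio_of_tendsto (hφ : IsParabolicSelfMap φ) (hz : z ∈ upperHalf) {T : ℝ}
    (hT : Tendsto (fun m => hypRatio (φ^[m] z) (φ (φ^[m] z))) atTop (𝓝 T)) (n : ℕ) {c : ℝ}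
    (hc : ∀ m, hypRatio (φ^[m] z) (φ^[m + n] z) ≤ c) : (n : ℝ) ^ 2 * T ≤ c := by
  have hmem := hφ.iterate_mem hz
  have hpos : ∀ m, 0 < (φ^[m] z).im := hmem
  -- Steps at bounded shifts of this subsequence share the limit q, so the rescaled orbit converges
  -- to that of an affine map.
  obtain ⟨q, -, ξ, hξ, hq⟩ := tendsto_subseq_of_bounded
    (Metric.isBounded_closedBall (x := (0 : ℂ)) (r := 1 + hypRatio z (φ z)))
    (x := fun m => normStep φ (φ^[m] z))
    (fun m => by simpa using norm_normStep_orbit_le hφ hz m)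
  have hshift : ∀ j, Tendsto (fun k => normStep φ (φ^[ξ k + j] z)) atTop (𝓝 q) := by
    intro j
    induction j with
    | zero => exact hq
    | succ j ih =>
      have h := ih.add ((tendsto_normStep_sub hφ hz hT).comp
        ((tendsto_add_atTop_nat j).comp hξ.tendsto_atTop))
      rw [add_zero] at h
      refine h.congr fun k => ?_
      simp only [Function.comp, add_assoc, add_sub_cancel]
  have hq0 : 0 ≤ q.im := ge_of_tendsto' ((Complex.continuous_im.tendsto q).comp hq)
    fun k => normStep_im_nonneg hφ (hmem _)
  set κ := 1 + q.im with hκ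
  have hκ0 : 0 < κ := by positivity
  have him : ∀ j, Tendsto (fun k => (φ^[ξ k + j] z).im / (φ^[ξ k] z).im) atTop (𝓝 (κ ^ j)) := by
    intro j
    induction j with
    | zero => simp [div_self (hpos _).ne']
    | succ j ih =>
      have h := ih.mul (((Complex.continuous_im.tendsto q).comp (hshift j)).const_add 1)
      rw [pow_succ]
      refine h.congr fun k => ?_
      rw [← add_assoc, Function.iterate_succ_apply', im_map_eq (hmem _)]
      simp only [Function.comp]
      ring
  have hdisp : ∀ j, Tendsto (fun k => (φ^[ξ k + j] z - φ^[ξ k] z) / ((φ^[ξ k] z).im : ℂ)) atTop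
      (𝓝 (q * ((∑ i ∈ Finset.range j, κ ^ i : ℝ) : ℂ))) := by
    intro j
    induction j with
    | zero => simp
    | succ j ih =>
      have h := ih.add ((hshift j).mul ((Complex.continuous_ofReal.tendsto _).comp (him j)))
      rw [Finset.sum_range_succ, Complex.ofReal_add, mul_add]
      refine h.congr fun k => ?_
      have e := map_sub_eq (φ := φ) (hmem (ξ k + j))
      rw [← add_assoc, Function.iterate_succ_apply']
      have e2 : φ (φ^[ξ k + j] z) - φ^[ξ k] z = (φ^[ξ k + j] z - φ^[ξ k] z) +
        (φ (φ^[ξ k + j] z) - φ^[ξ k + j] z) := by ring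
      rw [e2, e]
      simp only [Function.comp]
      push_cast
      ring
  have hTq : T = ‖q‖ ^ 2 / κ := by
    refine tendsto_nhds_unique (hT.comp hξ.tendsto_atTop) ?_
    have h := (hq.norm.pow 2).div (((Complex.continuous_im.tendsto q).comp hq).const_add 1) hκ0.ne'
    refine h.congr fun k => ?_
    simp only [Pi.div_apply, Function.comp]
    rw [hypRatio_map_eq (hmem _)]
  have hlim : Tendsto (fun k => hypRatio (φ^[ξ k] z) (φ^[ξ k + n] z)) atTop
      (𝓝 (‖q * ((∑ i ∈ Finset.range n, κ ^ i : ℝ) : ℂ)‖ ^ 2 / κ ^ n)) := by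
    have h := ((hdisp n).norm.pow 2).div (him n) (by positivity)
    refine h.congr fun k => ?_
    have h1 := hpos (ξ k)
    have h2 := hpos (ξ k + n)
    rw [Pi.div_apply, norm_div, Complex.norm_real, Real.norm_eq_abs, abs_of_pos h1, hypRatio]
    field_simp
  refine le_trans ?_ (le_of_tendsto' hlim fun k => hc (ξ k))
  rw [hTq, norm_mul, mul_pow, Complex.norm_real, Real.norm_eq_abs, sq_abs, ← mul_div_assoc,
    div_le_div_iff₀ hκ0 (by positivity)]
  have := mul_le_mul_of_nonneg_left (sq_mul_pow_le_geom_sum_sq hκ0.le n) (sq_nonneg ‖q‖)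
  linarith

end Steps

/-! ### Comparison of two orbits. -/

lemma im_le_of_hypRatio_le {z w : ℂ} (hz : 0 < z.im) (hw : 0 < w.im) {K : ℝ}
    (h : hypRatio z w ≤ K) : w.im ≤ (K + 2) * z.im := by
  rw [hypRatio, div_le_iff₀ (mul_pos hz hw), norm_sq_eq_re_im, Complex.sub_im] at h
  have h2 : w.im * w.im ≤ ((K + 2) * z.im) * w.im := by
    nlinarith [sq_nonneg (w - z).re, sq_nonneg z.im]
  exact le_of_mul_le_mul_right h2 hw

/-- At bounded hyperbolic distance, a small step at u together with a bounded step at v forces a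
small step at v. -/
lemma norm_normStep_sq_le_of_hypRatio_le {φ : ℂ → ℂ} (hφ : IsParabolicSelfMap φ) {v u : ℂ}
    (hv : v ∈ upperHalf) (hu : u ∈ upperHalf) {K : ℝ} (hK : hypRatio v u ≤ K) :
    ‖normStep φ v‖ ^ 2 ≤ 2 * ((K + 2) * ‖normStep φ u‖) ^ 2 +
      2 * K * ((K + 2) * ‖normStep φ u‖) * ‖normStep φ v‖ := by
  have hv0 : 0 < v.im := hv
  have hu0 : 0 < u.im := hu
  have hK0 : 0 ≤ K := (hypRatio_nonneg hv0 hu0).trans hK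
  have hsp := hφ.norm_displacement_sub_sq_le hv hu
  set p := φ v - v with hp
  set r := φ u - u with hr
  have hp0 : 0 ≤ p.im := by simpa [hp] using hφ.im_le hv
  have hr0 : 0 ≤ r.im := by simpa [hr] using hφ.im_le hu
  have hpn : p.im ≤ ‖p‖ := (le_abs_self _).trans (Complex.abs_im_le_norm _)
  have hrn : r.im ≤ ‖r‖ := (le_abs_self _).trans (Complex.abs_im_le_norm _)
  have h1 : ‖r - p‖ ^ 2 ≤ K * (‖p‖ * ‖r‖) := hsp.trans (by gcongr)
  have h2 : ‖p‖ ≤ ‖r‖ + ‖r - p‖ := by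
    have := norm_sub_le r (r - p)
    simpa using this
  have h3 : ‖p‖ ^ 2 ≤ 2 * ‖r‖ ^ 2 + 2 * K * ‖r‖ * ‖p‖ := by
    have := pow_le_pow_left₀ (norm_nonneg _) h2 2
    nlinarith [sq_nonneg (‖r‖ - ‖r - p‖)]
  have h4 : ‖r‖ / v.im ≤ (K + 2) * ‖normStep φ u‖ := by
    rw [norm_normStep hu, div_le_iff₀ hv0, ← hr]
    have := im_le_of_hypRatio_le hv0 hu0 hK
    calc ‖r‖ = ‖r‖ / u.im * u.im := by field_simp
      _ ≤ ‖r‖ / u.im * ((K + 2) * v.im) := by gcongr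
      _ = _ := by ring
  have h5 : ‖normStep φ v‖ ^ 2 ≤
      2 * (‖r‖ / v.im) ^ 2 + 2 * K * (‖r‖ / v.im) * ‖normStep φ v‖ := by
    rw [norm_normStep hv, ← hp]
    have := div_le_div_of_nonneg_right h3 (sq_nonneg v.im)
    calc _ = ‖p‖ ^ 2 / v.im ^ 2 := by ring
      _ ≤ _ := this
      _ = _ := by field_simp
  refine h5.trans ?_
  gcongr

/-- For a type I map every forward orbit has non-zero step. -/
lemma IsTypeI.exists_pos_tendsto {φ : ℂ → ℂ} (hI : IsTypeI φ) (hφ : IsParabolicSelfMap φ) {z : ℂ}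
    (hz : z ∈ upperHalf) :
    ∃ T : ℝ, 0 < T ∧ Tendsto (fun m => hypRatio (φ^[m] z) (φ (φ^[m] z))) atTop (𝓝 T) := by
  obtain ⟨s, hs, hlim⟩ := hI
  have hbdd : BddBelow (Set.range fun m => hypRatio (φ^[m] z) (φ (φ^[m] z))) :=
    ⟨0, by rintro _ ⟨m, rfl⟩; exact hypRatio_orbit_nonneg hφ hz m⟩
  have hT := tendsto_atTop_ciInf (antitone_hypRatio_orbit hφ hz) hbdd
  refine ⟨_, ?_, hT⟩
  set T := ⨅ m, hypRatio (φ^[m] z) (φ (φ^[m] z))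
  have hT0 : 0 ≤ T := ge_of_tendsto' hT (hypRatio_orbit_nonneg hφ hz)
  by_contra! hle
  have hTz : Tendsto (fun m => hypRatio (φ^[m] z) (φ (φ^[m] z))) atTop (𝓝 0) :=
    le_antisymm hle hT0 ▸ hT
  have hi : Complex.I ∈ upperHalf := by simp [upperHalf]
  have hu : Tendsto (fun m => ‖normStep φ (φ^[m] z)‖) atTop (𝓝 0) := by
    have hsq : Tendsto (fun m => ‖normStep φ (φ^[m] z)‖ ^ 2) atTop (𝓝 0) := by
      refine squeeze_zero (fun m => sq_nonneg _) (fun m => ?_)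
        (by simpa using hTz.mul_const (1 + (1 + hypRatio z (φ z))))
      refine (norm_normStep_le hφ (hφ.iterate_mem hz m)).trans ?_
      have h1 := hypRatio_orbit_nonneg hφ hz m
      have h2 := norm_normStep_orbit_le hφ hz m
      gcongr
    simpa [Real.sqrt_sq] using hsq.sqrt
  set K := hypRatio Complex.I z
  set M := 1 + hypRatio Complex.I (φ Complex.I)
  have hK0 : 0 ≤ K := hypRatio_nonneg hi hz
  have hbound : Tendsto (fun m => 2 * ((K + 2) * ‖normStep φ (φ^[m] z)‖) ^ 2 +
      2 * K * ((K + 2) * ‖normStep φ (φ^[m] z)‖) * M) atTop (𝓝 0) := by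
    have h := (((hu.const_mul (K + 2)).pow 2).const_mul 2).add
      (((hu.const_mul (K + 2)).const_mul (2 * K)).mul_const M)
    simpa using h
  have hv : Tendsto (fun m => pseudoHypDist (φ^[m] Complex.I) (φ^[m + 1] Complex.I) ^ 2) atTop
      (𝓝 0) := by
    refine squeeze_zero (fun m => sq_nonneg _) (fun m => ?_) hbound
    have hm := hφ.iterate_mem hi m
    have hnn := hypRatio_orbit_nonneg hφ hi m
    have him := normStep_im_nonneg hφ hm
    rw [Function.iterate_succ_apply', pseudoHypDist_sq hm (hφ.mapsTo hm)]
    have h1 : hypRatio (φ^[m] Complex.I) (φ (φ^[m] Complex.I)) /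
        (hypRatio (φ^[m] Complex.I) (φ (φ^[m] Complex.I)) + 4) ≤
        hypRatio (φ^[m] Complex.I) (φ (φ^[m] Complex.I)) := div_le_self hnn (by linarith)
    have h2 : hypRatio (φ^[m] Complex.I) (φ (φ^[m] Complex.I)) ≤
        ‖normStep φ (φ^[m] Complex.I)‖ ^ 2 := by
      rw [hypRatio_map_eq hm]
      exact div_le_self (sq_nonneg _) (by linarith)
    have h3 := norm_normStep_sq_le_of_hypRatio_le hφ hm (hφ.iterate_mem hz m)
      (hypRatio_iterate_le hφ m hi hz)
    refine (h1.trans h2).trans (h3.trans ?_)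
    have := norm_normStep_orbit_le hφ hi m
    gcongr
  have := tendsto_nhds_unique hv (hlim.pow 2)
  exact absurd this.symm (by positivity)

/-! ### The running-mean argument. -/

/-- A positive sequence whose terms are at most a constant times the square of the running mean,
and whose series diverges, does not tend to zero. -/
lemma not_tendsto_zero_of_le_sq_mean {y : ℕ → ℝ} (hy : ∀ n, 0 < y n) {B : ℝ} (hB : 0 < B)
    (hdiv : Tendsto (fun n => ∑ k ∈ Finset.range n, y k) atTop atTop)
    (h : ∀ n : ℕ, (n : ℝ) ^ 2 * y n ≤ B * (∑ k ∈ Finset.range n, y k) ^ 2) :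
    ¬ Tendsto y atTop (𝓝 0) := by
  intro h0
  set S : ℕ → ℝ := fun n => ∑ k ∈ Finset.range n, y k with hS
  have hSpos : ∀ n, 0 < S (n + 1) := fun n =>
    Finset.sum_pos (fun k _ => hy k) ⟨0, by simp⟩
  -- Discrete form of (1/S)' ≥ -B/n². The index starts at 1 because S 0 = 0; the factor 2 absorbs
  -- replacing 1/n² by 1/(n(n+1)).
  have hmono : Monotone fun n : ℕ => (S (n + 1))⁻¹ - 2 * B * ((n : ℝ) + 1)⁻¹ := by
    refine monotone_nat_of_le_succ fun n => ?_
    have h1 := hSpos n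
    have h2 := hSpos (n + 1)
    have hs : S (n + 1 + 1) = S (n + 1) + y (n + 1) := Finset.sum_range_succ _ _
    have hn := h (n + 1)
    have hy1 := hy (n + 1)
    push_cast at hn
    have e1 : (S (n + 1))⁻¹ - (S (n + 1 + 1))⁻¹ = y (n + 1) / (S (n + 1) * S (n + 1 + 1)) := by
      rw [hs] at h2 ⊢
      field_simp
      ring
    have e2 : y (n + 1) / (S (n + 1) * S (n + 1 + 1)) ≤ B / ((n : ℝ) + 1) ^ 2 := by
      rw [div_le_div_iff₀ (by positivity) (by positivity)]
      calc y (n + 1) * ((n : ℝ) + 1) ^ 2 ≤ B * S (n + 1) ^ 2 := by rw [mul_comm]; exact hn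
        _ ≤ B * (S (n + 1) * S (n + 1 + 1)) := by
          rw [sq]
          gcongr
          linarith
    have e3 : B / ((n : ℝ) + 1) ^ 2 ≤
        2 * B * ((n : ℝ) + 1)⁻¹ - 2 * B * ((n : ℝ) + 1 + 1)⁻¹ := by
      have : 2 * B * ((n : ℝ) + 1)⁻¹ - 2 * B * ((n : ℝ) + 1 + 1)⁻¹ =
          2 * B / (((n : ℝ) + 1) * ((n : ℝ) + 1 + 1)) := by field_simp; ring
      rw [this, div_le_div_iff₀ (by positivity) (by positivity)]
      have hn0 : (0 : ℝ) ≤ n := Nat.cast_nonneg n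
      have : ((n : ℝ) + 1) * ((n : ℝ) + 1 + 1) ≤ 2 * ((n : ℝ) + 1) ^ 2 := by nlinarith
      calc _ ≤ B * (2 * ((n : ℝ) + 1) ^ 2) := by gcongr
        _ = _ := by ring
    push_cast
    linarith
  have hlim : Tendsto (fun n : ℕ => (S (n + 1))⁻¹ - 2 * B * ((n : ℝ) + 1)⁻¹) atTop (𝓝 0) := by
    have h1 := tendsto_inv_atTop_zero.comp (hdiv.comp (tendsto_add_atTop_nat 1))
    have h2 := (tendsto_inv_atTop_zero.comp
      (tendsto_atTop_add_const_right _ (1 : ℝ) tendsto_natCast_atTop_atTop)).const_mul (2 * B)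
    simpa using h1.sub h2
  have hmean : Tendsto (fun n : ℕ => ((n + 1 : ℕ) : ℝ)⁻¹ * S (n + 1)) atTop (𝓝 0) :=
    h0.cesaro.comp (tendsto_add_atTop_nat 1)
  have hge : ∀ n : ℕ, (2 * B)⁻¹ ≤ ((n + 1 : ℕ) : ℝ)⁻¹ * S (n + 1) := by
    intro n
    have h1 := hmono.ge_of_tendsto hlim n
    have h2 := hSpos n
    have h3 : (S (n + 1))⁻¹ ≤ 2 * B * ((n : ℝ) + 1)⁻¹ := by linarith
    push_cast
    calc (2 * B)⁻¹ = (2 * B)⁻¹ * (S (n + 1))⁻¹ * S (n + 1) := by field_simp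
      _ ≤ (2 * B)⁻¹ * (2 * B * ((n : ℝ) + 1)⁻¹) * S (n + 1) := by gcongr
      _ = _ := by field_simp
  have := ge_of_tendsto' hmean hge
  exact absurd this (not_le.mpr (by positivity))

/-! ### Backward orbits and the conclusion. -/

lemma IsBISBS.iterate_eq {φ : ℂ → ℂ} {w : ℕ → ℂ} (hw : IsBISBS φ w) (n : ℕ) :
    φ^[n] (w n) = w 0 := by
  induction n with
  | zero => rfl
  | succ n ih => rw [Function.iterate_succ_apply, hw.map_succ, ih]

lemma IsBISBS.exists_hypRatio_le {φ : ℂ → ℂ} {w : ℕ → ℂ} (hw : IsBISBS φ w) :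
    ∃ A : ℝ, 0 < A ∧ ∀ n, hypRatio (w n) (w (n + 1)) ≤ A ^ 2 := by
  obtain ⟨a, ha, h⟩ := hw.bounded_steps
  have ha0 : 0 ≤ a := (norm_nonneg _).trans (h 0)
  have ha2 : a ^ 2 < 1 := by nlinarith
  -- Solving h/(h + 4) ≤ a² gives h ≤ 4a²/(1 - a²); dropping a² from the numerator keeps A positive
  -- when a = 0.
  refine ⟨√(4 / (1 - a ^ 2)), Real.sqrt_pos.mpr (div_pos four_pos (by linarith)), fun n => ?_⟩
  have h1 := pow_le_pow_left₀ (norm_nonneg _) (h n) 2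
  change pseudoHypDist _ _ ^ 2 ≤ _ at h1
  have h2 := hypRatio_nonneg (hw.mem n) (hw.mem (n + 1))
  rw [pseudoHypDist_sq (hw.mem n) (hw.mem (n + 1)), div_le_iff₀ (by linarith)] at h1
  rw [Real.sq_sqrt (div_nonneg four_pos.le (by linarith)), le_div_iff₀ (by linarith)]
  nlinarith

theorem theorem1p19 (φ : ℂ → ℂ) (hφ : IsParabolicSelfMap φ) (hI : IsTypeI φ)
    (w : ℕ → ℂ) (hw : IsBISBS φ w) (hinf : Tendsto w atTop (Bornology.cobounded ℂ)) :
    Antitone (fun n => (w n).im) ∧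
      ∃ l : ℝ, 0 < l ∧ Tendsto (fun n => (w n).im) atTop (𝓝 l) := by
  have hpos : ∀ n, 0 < (w n).im := hw.mem
  have hanti : Antitone fun n => (w n).im := antitone_nat_of_succ_le fun n => by
    simpa only [hw.map_succ] using hφ.im_le (hw.mem (n + 1))
  refine ⟨hanti, _, ?_, tendsto_atTop_ciInf hanti ⟨0, by rintro _ ⟨n, rfl⟩; exact (hpos n).le⟩⟩
  have hlim := tendsto_atTop_ciInf hanti ⟨0, by rintro _ ⟨n, rfl⟩; exact (hpos n).le⟩
  refine lt_of_le_of_ne (ge_of_tendsto' hlim fun n => (hpos n).le) fun h0 => ?_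
  rw [← h0] at hlim
  obtain ⟨T, hT0, hT⟩ := hI.exists_pos_tendsto hφ (hw.mem 0)
  obtain ⟨A, hA0, hA⟩ := hw.exists_hypRatio_le
  have hstep : ∀ n, ‖w (n + 1) - w n‖ ≤ A * (w n).im := by
    intro n
    refine (pow_le_pow_iff_left₀ (norm_nonneg _) (mul_nonneg hA0.le (hpos n).le)
      two_ne_zero).mp ?_
    have h1 := hA n
    rw [hypRatio, div_le_iff₀ (mul_pos (hpos n) (hpos (n + 1)))] at h1
    refine h1.trans ?_
    rw [mul_pow, sq (w n).im]
    have := hanti (Nat.le_succ n)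
    have := (hpos n).le
    gcongr
  have hdist : ∀ n, ‖w n - w 0‖ ≤ A * ∑ k ∈ Finset.range n, (w k).im := by
    intro n
    rw [← Finset.sum_range_sub w n, Finset.mul_sum]
    exact norm_sum_le_of_le _ fun k _ => hstep k
  have hdiv : Tendsto (fun n => ∑ k ∈ Finset.range n, (w k).im) atTop atTop := by
    have h1 : Tendsto (fun n => A⁻¹ * (‖w n‖ - ‖w 0‖)) atTop atTop :=
      (tendsto_atTop_add_const_right _ (-‖w 0‖)
        (tendsto_norm_cobounded_atTop.comp hinf)).const_mul_atTop (inv_pos.mpr hA0)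
    refine tendsto_atTop_mono (fun n => ?_) h1
    rw [inv_mul_le_iff₀ hA0]
    exact (norm_sub_norm_le _ _).trans (hdist n)
  have hlower : ∀ n : ℕ, (n : ℝ) ^ 2 * T ≤ hypRatio (w n) (w 0) := by
    intro n
    refine sq_mul_le_hypRatio_of_tendsto hφ (hw.mem 0) hT n fun m => ?_
    -- The iterate `φ^[m + n]` carries `w n` to `φ^[m] (w 0)`, so this pair lies n steps apart on
    -- the orbit of `w 0`.
    have h1 := hypRatio_iterate_le hφ (m + n) (hw.mem n) (hw.mem 0)
    rwa [Function.iterate_add_apply φ m n (w n), hw.iterate_eq] at h1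
  refine not_tendsto_zero_of_le_sq_mean hpos (B := A ^ 2 / (T * (w 0).im))
    (div_pos (by positivity) (mul_pos hT0 (hpos 0))) hdiv (fun n => ?_) hlim
  have h1 := hlower n
  have hn := hpos n
  have h00 := hpos 0
  rw [hypRatio, norm_sub_rev, le_div_iff₀ (mul_pos hn h00)] at h1
  have h2 := pow_le_pow_left₀ (norm_nonneg _) (hdist n) 2
  rw [div_mul_eq_mul_div, le_div_iff₀ (mul_pos hT0 h00)]
  calc _ = (n : ℝ) ^ 2 * T * ((w n).im * (w 0).im) := by ring
    _ ≤ _ := h1.trans h2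
    _ = _ := by ring
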